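/- Let $d\ge 0$ and let $M_1,\dots,M_d$ be positive integers. For each $x\in\mathbb Z^d$ let $p_x$ be a probability measure on $\mathbb Z^d$ such that $p_{x+M_ie_i}=p_x$ for all $x$ and $i$, where $e_i$ is the $i$th unit vector. Let $(X_n)_{n\ge0}$ be the Markov chain on $\mathbb Z^d$ with $X_0=0$ and $\mathbb P(X_{n+1}=x+y\mid X_n=x)=p_x(y)$. Let $T=\mathbb Z^d/(M_1\mathbb Z\times\dots\times M_d\mathbb Z)$, identified with $\{0,\dots,M_1-1\}\times\dots\times\{0,\dots,M_d-1\}$, and write $u\sim v$ if $u,v\in\mathbb Z^d$ represent the same element of $T$. Let $\xi_n\in T$ be the class of $X_n$; it is a Markov chain with transition matrix $P_{xy}=\sum_{z\in\mathbb Z^d:\,x+z\sim y}p_x(z)$, $x,y\in T$. Let $$\mu_{xy}=\frac{\sum_{z:\,x+z\sim y}z\,p_x(z)}{\sum_{z:\,x+z\sim y}p_x(z)}$$ be the conditional mean of a jump given that it goes from the class $x$ to the class $y$, and $\mu_{xy}=0$ if no such jump is possible. Suppose that the induced chain $\xi_n$ is irreducible and aperiodic and that $\sum_{y\in\mathbb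 Z^d}|y|^2p_x(y)<\infty$ for all $x\in T$. Then $P$ has a unique stationary probability vector $\pi$. Put $\nu=\sum_{x\in T}\pi(x)\sum_{y\in\mathbb Z^d}p_x(y)\,y$. The matrix $I-P$ maps the space $\{f:T\to\mathbb R:\ \sum_x\pi(x)f(x)=0\}$ of functions of $\pi$-mean zero bijectively onto itself; let $(I-P)^{-1}$ denote the inverse on this space. The functions $f_j(z)=\sum_{w\in T}P_{zw}((\mu_{zw})_j-\nu_j)$, $1\le j\le d$, have $\pi$-mean zero, and $$\frac{X_n-n\nu}{\sqrt n}\Longrightarrow\mathcal N(0,\Sigma)$$ in distribution as $n\to\infty$, where $\Sigma$ is the positive semidefinite symmetric matrix $$\Sigma_{ij}=\sum_{x\in T}\pi(x)\sum_{y\in\mathbb Z^d}p_x(y)(y_i-\nu_i)(y_j-\nu_j)+L_{ij}+L_{ji},$$ $$L_{ij}=\sum_{x,y\in T}\pi(x)P_{xy}\big((\mu_{xy})_i-\nu_i\big)\big((I-P)^{-1}f_j\big)(y)=\sum_{x,y,z,w\in T}\pi(x)P_{xy}\big((\mu_{xy})_i-\nu_i\big)(I-P)^{-1}_{yz}P_{zw}\big((\mu_{zw})_j-\nu_j\big),$$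 the last expression being the formal matrix notation for the one before it. -/

import Mathlib

open MeasureTheory ProbabilityTheory Filter Topology
open scoped Matrix

namespace RWPE

/-- An environment on `ℤ^d`: for each site `x`, the law `p x` of the jump made from `x`, so that
`p x y` is the probability of the jump `x ↦ x + y`. -/
abbrev Environment (d : ℕ) := (Fin d → ℤ) → PMF (Fin d → ℤ)

/-- The environment is periodic with period `M i` in the `i`th coordinate direction. -/
def IsPeriodic {d : ℕ} (M : Fin d → ℕ) (p : Environment d) : Prop :=
  ∀ (i : Fin d) (x : Fin d → ℤ), p (x + Pi.single i (M i : ℤ)) = p x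

/-- `X` is a random walk in the (fixed) environment `p`, under the law `Pr`: the Markov chain on
`ℤ^d` that starts at `0` and jumps from `x` to `x + y` with probability `p x y`. -/
structure IsWalk {d : ℕ} {Ω : Type*} [MeasurableSpace Ω] (p : Environment d)
    (X : ℕ → Ω → (Fin d → ℤ)) (Pr : Measure Ω) : Prop where
  measurable : ∀ n, Measurable (X n)
  start : ∀ᵐ ω ∂Pr, X 0 ω = 0
  step : ∀ (n : ℕ) (x : ℕ → (Fin d → ℤ)),
    Pr {ω | ∀ k ≤ n + 1, X k ω = x k} =
      Pr {ω | ∀ k ≤ n, X k ω = x k} * p (x n) (x (n + 1) - x n)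

/-- A lattice point as a vector of the Euclidean space `ℝ^d`. -/
noncomputable def toEuc {d : ℕ} (y : Fin d → ℤ) : EuclideanSpace ℝ (Fin d) :=
  WithLp.toLp 2 (fun i => (y i : ℝ))

/-- The torus `ℤ^d / (M₁ℤ × ⋯ × M_dℤ)`. -/
abbrev Torus {d : ℕ} (M : Fin d → ℕ) := (i : Fin d) → ZMod (M i)

section Induced

variable {d : ℕ} (M : Fin d → ℕ)

/-- The equivalence class of a lattice point. -/
def toTorus (z : Fin d → ℤ) : Torus M := fun i => (z i : ZMod (M i))

/-- The representative of a class in `{0, …, M₁ - 1} × ⋯ × {0, …, M_d - 1}`. -/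
def rep (x : Torus M) : Fin d → ℤ := fun i => ((x i).val : ℤ)

/-- `p_x(y)` as a real number, for `x` in the torus. -/
noncomputable def jump (p : Environment d) (x : Torus M) (y : Fin d → ℤ) : ℝ :=
  (p (rep M x) y).toReal

/-- The transition matrix `P` of the induced chain on the torus: `P x y` is the total probability
of the jumps from (the representative of) `x` that end in the class `y`. -/
noncomputable def transition (p : Environment d) : Matrix (Torus M) (Torus M) ℝ :=
  fun x y => ∑' z : Fin d → ℤ, if toTorus M (rep M x + z) = y then jump M p x z else 0

/-- The `i`th coordinate of `μ_{xy}`, the conditional mean of the jump given that it goes from the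
class `x` to the class `y`; it is `0` (as `0 / 0`) if no such jump is possible. -/
noncomputable def condMean (p : Environment d) (x y : Torus M) (i : Fin d) : ℝ :=
  (∑' z : Fin d → ℤ, if toTorus M (rep M x + z) = y then (z i : ℝ) * jump M p x z else 0) /
    transition M p x y

end Induced

section Chain

variable {T : Type*} [Fintype T] [DecidableEq T]

/-- Aperiodicity: for each state `x`, the greatest common divisor of the possible return times to
`x` is `1`. -/
def IsAperiodic (P : Matrix T T ℝ) : Prop :=
  ∀ (x : T) (m : ℕ), (∀ n : ℕ, 0 < n → 0 < (P ^ n) x x → m ∣ n) → m = 1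

/-- `π` is a stationary probability vector of `P`. -/
def IsStationary (P : Matrix T T ℝ) (π : T → ℝ) : Prop :=
  (∀ x, 0 ≤ π x) ∧ ∑ x, π x = 1 ∧ π ᵥ* P = π

/-- The functions on the state space that have `π`-mean zero. -/
def meanZero (π : T → ℝ) : Set (T → ℝ) := {f | π ⬝ᵥ f = 0}

/-- `(I - P)⁻¹ f`, where `(I - P)⁻¹` is the inverse of the restriction of `I - P` to the functions
of `π`-mean zero (`I - P` itself annihilates the constants, so it is never invertible on all
functions). -/
noncomputable def invOneSub (P : Matrix T T ℝ) (π : T → ℝ) (f : T → ℝ) : T → ℝ :=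
  Function.invFunOn (fun h : T → ℝ => (1 - P) *ᵥ h) (meanZero π) f

end Chain

section Limit

variable {d : ℕ} (M : Fin d → ℕ) [∀ i, NeZero (M i)]

/-- The asymptotic velocity `ν = ∑ₓ π(x) ∑_y p_x(y) y`. -/
noncomputable def velocity (p : Environment d) (π : Torus M → ℝ) : EuclideanSpace ℝ (Fin d) :=
  WithLp.toLp 2 (fun i => ∑ x, π x * ∑' y : Fin d → ℤ, jump M p x y * (y i : ℝ))

/-- `∑ₓ π(x) ∑_y p_x(y) (y_i - ν_i) (y_j - ν_j)`. -/
noncomputable def covOne (p : Environment d) (π : Torus M → ℝ) (i j : Fin d) : ℝ :=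
  ∑ x, π x * ∑' y : Fin d → ℤ,
    jump M p x y * ((y i : ℝ) - velocity M p π i) * ((y j : ℝ) - velocity M p π j)

/-- `∑_{x,y,z,w} π(x) P_{xy} ((μ_{xy})_i - ν_i) (I - P)⁻¹_{yz} P_{zw} ((μ_{zw})_j - ν_j)`. -/
noncomputable def covLag (p : Environment d) (π : Torus M → ℝ) (i j : Fin d) : ℝ :=
  ∑ x, ∑ y, π x * transition M p x y * (condMean M p x y i - velocity M p π i) *
    invOneSub (transition M p) π
      (fun z => ∑ w, transition M p z w * (condMean M p z w j - velocity M p π j)) y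

/-- The asymptotic covariance matrix `Σ`, by the Green–Kubo formula. -/
noncomputable def asympCov (p : Environment d) (π : Torus M → ℝ) : Matrix (Fin d) (Fin d) ℝ :=
  fun i j => covOne M p π i j + (covLag M p π i j + covLag M p π j i)

end Limit

end RWPE

/-! The proof combines a martingale correction with an approximate eigenfunction. The corrector `h_j
= (I - P)⁻¹ f_j` makes `X_n - nν + h(ξ_n)` a martingale up to its initial value, with increments
that depend only on the current class and the jump. Their stationary covariance is `Σ`
(`asympCov_eq`), which also shows `Σ ≥ 0`.

Fix a direction `u` and let `s = uᵀΣu`. The conditional variance of the increment along `u` still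
varies with the class, but its excess over `s` has `π`-mean zero, so a second Poisson equation
yields a function `w` that absorbs it. Multiplying `exp(iθ u·(X_n - nν + h(ξ_n)))` by `1 -
θ²w(ξ_n)/2` gives a quantity whose expectation is multiplied by `1 - θ²s/2` at each step, up to
`o(θ²)` uniformly in time (`integral_cexp_mul_isLittleO`, `norm_integral_step_le`). With `θ = 1/√n`,
the `n` errors add up to `o(1)` and `(1 - s/(2n))^n → exp(-s/2)`. Both corrections tend to `1` with
`θ`, so the characteristic functions converge and Lévy's continuity theorem concludes.

The Poisson equations are solvable because harmonic functions of an irreducible finite chain are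
constant (`bijOn_meanZero`). -/

namespace RWPE

/-! ### Finite irreducible chains: stationary vector and Poisson equation. -/

section FiniteChain

variable {T : Type*} [Fintype T] [DecidableEq T] {P : Matrix T T ℝ}

lemma pow_mulVec_eq_self {h : T → ℝ} (hh : P *ᵥ h = h) (n : ℕ) : (P ^ n) *ᵥ h = h := by
  induction n with
  | zero => simp
  | succ n ih => rw [pow_succ, ← Matrix.mulVec_mulVec, hh, ih]

lemma vecMul_pow_eq_self {v : T → ℝ} (hv : v ᵥ* P = v) (n : ℕ) : v ᵥ* (P ^ n) = v := by
  induction n with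
  | zero => simp
  | succ n ih => rw [pow_succ, ← Matrix.vecMul_vecMul, ih, hv]

lemma pow_apply_nonneg (hP : ∀ x y, 0 ≤ P x y) (n : ℕ) (x y : T) : 0 ≤ (P ^ n) x y := by
  induction n generalizing y with
  | zero => rw [pow_zero, Matrix.one_apply]; split_ifs <;> simp
  | succ n ih =>
    rw [pow_succ, Matrix.mul_apply]
    exact Finset.sum_nonneg fun z _ => mul_nonneg (ih z) (hP z y)

/-- The harmonic functions of an irreducible stochastic matrix are constant. -/
lemma harmonic_const [Nonempty T] (hirr : P.IsIrreducible) (h1 : P *ᵥ 1 = 1) {h : T → ℝ}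
    (hh : P *ᵥ h = h) : ∃ c : ℝ, h = fun _ => c := by
  obtain ⟨x₀, hx₀⟩ := Finite.exists_min h
  refine ⟨h x₀, funext fun y => ?_⟩
  obtain ⟨n, -, hn⟩ := (Matrix.isIrreducible_iff_exists_pow_pos hirr.nonneg).1 hirr x₀ y
  -- Minimum principle: `g` is harmonic, nonnegative and zero at `x₀`, so it vanishes at every state
  -- reachable from `x₀`.
  set g : T → ℝ := h - h x₀ • (1 : T → ℝ) with hg
  have hPg : P *ᵥ g = g := by
    rw [hg, Matrix.mulVec_sub, Matrix.mulVec_smul, h1, hh]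
  have hg0 : ∀ z, 0 ≤ g z := fun z => by simp [hg, hx₀ z]
  have h0 : ∑ z, (P ^ n) x₀ z * g z = 0 := by
    have := congrFun (pow_mulVec_eq_self hPg n) x₀
    rw [Matrix.mulVec, dotProduct] at this
    rw [this]; simp [hg]
  have h2 := (Finset.sum_eq_zero_iff_of_nonneg fun z _ =>
    mul_nonneg (pow_apply_nonneg hirr.nonneg n x₀ z) (hg0 z)).1 h0 y (Finset.mem_univ y)
  have h3 : g y = 0 := (mul_eq_zero.1 h2).resolve_left hn.ne'
  simpa [hg, sub_eq_zero] using h3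

lemma pos_of_vecMul_eq_self (hirr : P.IsIrreducible) {v : T → ℝ} (hv0 : ∀ x, 0 ≤ v x)
    (hv : v ᵥ* P = v) {x : T} (hx : 0 < v x) (y : T) : 0 < v y := by
  obtain ⟨n, -, hn⟩ := (Matrix.isIrreducible_iff_exists_pow_pos hirr.nonneg).1 hirr x y
  rw [← vecMul_pow_eq_self hv n, Matrix.vecMul, dotProduct]
  exact (mul_pos hx hn).trans_le (Finset.single_le_sum
    (f := fun z => v z * (P ^ n) z y)
    (fun z _ => mul_nonneg (hv0 z) (pow_apply_nonneg hirr.nonneg n z y)) (Finset.mem_univ x))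

omit [DecidableEq T] in
lemma sum_vecMul (h1 : P *ᵥ 1 = 1) (v : T → ℝ) : ∑ x, (v ᵥ* P) x = ∑ x, v x := by
  have := Matrix.dotProduct_mulVec v P 1
  rw [h1] at this
  simpa [dotProduct] using this.symm

omit [DecidableEq T] in
/-- The absolute value of an invariant signed vector is invariant. -/
lemma abs_vecMul_eq_self (hP : ∀ x y, 0 ≤ P x y) (h1 : P *ᵥ 1 = 1) {v : T → ℝ}
    (hv : v ᵥ* P = v) : (fun x => |v x|) ᵥ* P = fun x => |v x| := by
  have hle : ∀ y ∈ Finset.univ, |v y| ≤ ((fun x => |v x|) ᵥ* P) y := fun y _ => by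
    conv_lhs => rw [← hv]
    rw [Matrix.vecMul, dotProduct, Matrix.vecMul, dotProduct]
    refine (Finset.abs_sum_le_sum_abs _ _).trans_eq (Finset.sum_congr rfl fun z _ => ?_)
    rw [abs_mul, abs_of_nonneg (hP z y)]
  -- A stochastic matrix preserves total mass, so the pointwise inequality must be an equality.
  have := (Finset.sum_eq_sum_iff_of_le hle).1 (sum_vecMul h1 _).symm
  exact funext fun y => (this y (Finset.mem_univ y)).symm

/-- If `v` were positive somewhere, the nonnegative invariant vector `v + |v|` would be positive
everywhere by irreducibility. Then `v > 0` everywhere, against the zero sum. Hence `v ≤ 0`, and the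
zero sum forces `v = 0`. -/
lemma eq_zero_of_vecMul_eq_self (hirr : P.IsIrreducible) (h1 : P *ᵥ 1 = 1) {v : T → ℝ}
    (hv : v ᵥ* P = v) (hs : ∑ x, v x = 0) : v = 0 := by
  have key : ∀ x, v x ≤ 0 := by
    by_contra! hx
    obtain ⟨x, hx⟩ := hx
    have habs := abs_vecMul_eq_self hirr.nonneg h1 hv
    have hpos : ∀ y, 0 < v y + |v y| := by
      refine pos_of_vecMul_eq_self hirr (v := v + fun x => |v x|)
        (fun y => ?_) ?_ (x := x) ?_
      · simpa using (by linarith [neg_abs_le (v y)] : 0 ≤ v y + |v y|)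
      · rw [Matrix.add_vecMul, hv, habs]
      · simpa using (by positivity : 0 < v x + |v x|)
    have hv0 : ∀ y, 0 < v y := fun y => by
      by_contra! h
      have := hpos y
      rw [abs_of_nonpos h] at this
      simp at this
    exact (Finset.sum_pos (fun y _ => hv0 y) ⟨x, Finset.mem_univ x⟩).ne' hs
  exact funext fun x =>
    (Finset.sum_eq_zero_iff_of_nonpos fun y _ => key y).1 hs x (Finset.mem_univ x)

/-- An irreducible stochastic matrix on a finite set has a unique stationary vector. -/
theorem existsUnique_isStationary [Nonempty T] (hirr : P.IsIrreducible) (h1 : P *ᵥ 1 = 1) :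
    ∃! π : T → ℝ, IsStationary P π := by
  -- The constants are a right null vector of `1 - P`, so a left null vector exists; its absolute
  -- value, normalised, is the stationary vector.
  have hdet : (1 - P).det = 0 := by
    refine Matrix.exists_mulVec_eq_zero_iff.1 ⟨1, one_ne_zero, ?_⟩
    rw [Matrix.sub_mulVec, h1, Matrix.one_mulVec, sub_self]
  obtain ⟨v, hv0, hv⟩ := Matrix.exists_vecMul_eq_zero_iff.2 hdet
  rw [Matrix.vecMul_sub, Matrix.vecMul_one, sub_eq_zero] at hv
  have habs := abs_vecMul_eq_self hirr.nonneg h1 hv.symm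
  obtain ⟨x, hx⟩ : ∃ x, v x ≠ 0 := by
    by_contra! h
    exact hv0 (funext h)
  have hs : 0 < ∑ y, |v y| := Finset.sum_pos' (fun y _ => abs_nonneg _)
    ⟨x, Finset.mem_univ x, abs_pos.2 hx⟩
  refine ⟨(∑ y, |v y|)⁻¹ • fun y => |v y|, ⟨fun y => ?_, ?_, ?_⟩, ?_⟩
  · simp only [Pi.smul_apply, smul_eq_mul]; positivity
  · simp only [Pi.smul_apply, smul_eq_mul, ← Finset.mul_sum]
    exact inv_mul_cancel₀ hs.ne'
  · rw [Matrix.smul_vecMul, habs]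
  · rintro π ⟨-, hπ1, hπ⟩
    refine sub_eq_zero.1 (eq_zero_of_vecMul_eq_self hirr h1 ?_ ?_)
    · rw [Matrix.sub_vecMul, hπ, Matrix.smul_vecMul, habs]
    · simp only [Pi.sub_apply, Pi.smul_apply, smul_eq_mul, Finset.sum_sub_distrib,
        ← Finset.mul_sum, hπ1]
      rw [inv_mul_cancel₀ hs.ne', sub_self]

omit [DecidableEq T] in
lemma IsStationary.dotProduct_mulVec {π : T → ℝ} (hπ : IsStationary P π) (h : T → ℝ) :
    π ⬝ᵥ (P *ᵥ h) = π ⬝ᵥ h := by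
  rw [Matrix.dotProduct_mulVec, hπ.2.2]

/-- `I - P` is invertible on the functions of `π`-mean zero. -/
theorem bijOn_meanZero [Nonempty T] (hirr : P.IsIrreducible) (h1 : P *ᵥ 1 = 1) {π : T → ℝ}
    (hπ : IsStationary P π) :
    Set.BijOn (fun h : T → ℝ => (1 - P) *ᵥ h) (meanZero π) (meanZero π) := by
  let V : Submodule ℝ (T → ℝ) := LinearMap.ker (dotProductBilin ℝ ℝ π)
  have hV : ∀ h, h ∈ V ↔ h ∈ meanZero π := fun h => by simp [V, meanZero]
  have hmaps : ∀ h ∈ V, (1 - P).mulVecLin h ∈ V := fun h hh => by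
    rw [hV] at hh ⊢
    rw [meanZero, Set.mem_ofPred_eq] at hh ⊢
    rw [Matrix.mulVecLin_apply, Matrix.sub_mulVec, dotProduct_sub, hπ.dotProduct_mulVec,
      Matrix.one_mulVec, hh, sub_self]
  let L : V →ₗ[ℝ] V := (1 - P).mulVecLin.restrict hmaps
  have hinj : Function.Injective L := by
    rw [← LinearMap.ker_eq_bot, LinearMap.ker_eq_bot']
    rintro ⟨h, hh⟩ hL
    have hL' : (1 - P) *ᵥ h = 0 := congrArg Subtype.val hL
    rw [Matrix.sub_mulVec, Matrix.one_mulVec, sub_eq_zero] at hL'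
    obtain ⟨c, rfl⟩ := harmonic_const hirr h1 hL'.symm
    have h0 : π ⬝ᵥ (fun _ => c) = 0 := (hV _).1 hh
    rw [dotProduct, ← Finset.sum_mul, hπ.2.1, one_mul] at h0
    subst h0
    rfl
  -- The space of mean-zero functions is finite-dimensional.
  have hsurj := LinearMap.surjective_of_injective hinj
  refine ⟨fun h hh => (hV _).1 (hmaps h ((hV h).2 hh)), fun h hh k hk e => ?_, fun f hf => ?_⟩
  · exact congrArg Subtype.val (@hinj ⟨h, (hV h).2 hh⟩ ⟨k, (hV k).2 hk⟩ (Subtype.ext e))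
  · obtain ⟨⟨h, hh⟩, e⟩ := hsurj ⟨f, (hV f).2 hf⟩
    exact ⟨h, (hV h).1 hh, congrArg Subtype.val e⟩

lemma invOneSub_spec [Nonempty T] (hirr : P.IsIrreducible) (h1 : P *ᵥ 1 = 1) {π : T → ℝ}
    (hπ : IsStationary P π) {f : T → ℝ} (hf : f ∈ meanZero π) :
    invOneSub P π f - P *ᵥ invOneSub P π f = f := by
  have := Function.invFunOn_eq ((bijOn_meanZero hirr h1 hπ).surjOn hf)
  rw [Matrix.sub_mulVec, Matrix.one_mulVec] at this
  exact this

end FiniteChain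

/-! ### The Markov property of the walk. -/

section Walk

variable {d : ℕ} {Ω : Type*} [MeasurableSpace Ω] {p : Environment d} {X : ℕ → Ω → (Fin d → ℤ)}
  {Pr : Measure Ω}

/-- The one-step transition kernel of the walk in the environment `p`. -/
noncomputable def walkKernel (p : Environment d) : Kernel (Fin d → ℤ) (Fin d → ℤ) where
  toFun x := (p x).toMeasure.map (x + ·)
  measurable' := measurable_of_countable _

lemma walkKernel_apply (p : Environment d) (x : Fin d → ℤ) :
    walkKernel p x = (p x).toMeasure.map (x + ·) := rfl

instance (p : Environment d) : IsMarkovKernel (walkKernel p) :=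
  ⟨fun _ => Measure.isProbabilityMeasure_map (measurable_of_countable _).aemeasurable⟩

lemma walkKernel_apply_singleton (p : Environment d) (x y : Fin d → ℤ) :
    walkKernel p x {y} = p x (y - x) := by
  rw [walkKernel_apply, Measure.map_apply (measurable_of_countable _) (measurableSet_singleton y)]
  have : (x + ·) ⁻¹' {y} = {y - x} := by
    ext z
    rw [Set.mem_preimage, Set.mem_singleton_iff, Set.mem_singleton_iff, eq_sub_iff_add_eq']
  rw [this, PMF.toMeasure_apply_singleton _ _ (measurableSet_singleton _)]

/-- The law of the walk at time `n + 1` in terms of its law at time `n`. -/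
lemma IsWalk.map_succ (hX : IsWalk p X Pr) (n : ℕ) :
    Pr.map (X (n + 1)) = walkKernel p ∘ₘ Pr.map (X n) := by
  refine Measure.ext_of_singleton fun y => ?_
  -- The step rule concerns full histories. There are countably many, so both sides are split
  -- according to the history up to time `n`.
  let V : Ω → (Fin (n + 1) → Fin d → ℤ) := fun ω k => X k ω
  have hV : Measurable V := measurable_pi_lambda _ fun k => hX.measurable k
  have hm : MeasurableSet (X (n + 1) ⁻¹' {y}) := hX.measurable _ (measurableSet_singleton y)
  rw [Measure.map_apply (hX.measurable _) (measurableSet_singleton y),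
    Measure.bind_apply (measurableSet_singleton y) (Kernel.aemeasurable _),
    lintegral_map (measurable_of_countable _) (hX.measurable n)]
  simp_rw [walkKernel_apply_singleton]
  have h1 : ∫⁻ ω, p (X n ω) (y - X n ω) ∂Pr =
      ∫⁻ v, p (v (Fin.last n)) (y - v (Fin.last n)) ∂(Pr.map V) := by
    rw [lintegral_map (measurable_of_countable _) hV]
    rfl
  have h2 : Pr (X (n + 1) ⁻¹' {y}) = ∫⁻ _, 1 ∂(Pr.restrict (X (n + 1) ⁻¹' {y})).map V := by
    rw [lintegral_one, Measure.map_apply hV MeasurableSet.univ, Set.preimage_univ,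
      Measure.restrict_apply_univ]
  rw [h1, lintegral_countable', h2, lintegral_countable']
  refine tsum_congr fun v => ?_
  -- The history `v` followed by `y` at time `n + 1`; later values play no role.
  let x : ℕ → (Fin d → ℤ) := fun k => if h : k < n + 1 then v ⟨k, h⟩ else y
  rw [one_mul, Measure.map_apply hV (measurableSet_singleton v), Measure.restrict_apply' hm,
    Measure.map_apply hV (measurableSet_singleton v)]
  have hs : V ⁻¹' {v} = {ω | ∀ k ≤ n, X k ω = x k} := by
    ext ω
    simp only [Set.mem_preimage, Set.mem_singleton_iff, Set.mem_ofPred_eq, funext_iff (f := V ω), V,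
      x]
    refine ⟨fun h k hk => ?_, fun h k => ?_⟩
    · rw [dif_pos (Nat.lt_succ_of_le hk), ← h]
    · rw [h k (Nat.le_of_lt_succ k.2), dif_pos k.2]
  have hs' : V ⁻¹' {v} ∩ X (n + 1) ⁻¹' {y} = {ω | ∀ k ≤ n + 1, X k ω = x k} := by
    rw [hs]
    ext ω
    simp only [Set.mem_inter_iff, Set.mem_ofPred_eq, Set.mem_preimage, Set.mem_singleton_iff]
    have hx : x (n + 1) = y := by simp [x]
    refine ⟨fun h k hk => ?_, fun h => ⟨fun k hk => h k (hk.trans (Nat.le_succ n)), ?_⟩⟩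
    · rcases Nat.le_succ_iff.1 hk with hk | rfl
      · exact h.1 k hk
      · rw [h.2, hx]
    · rw [h _ le_rfl, hx]
  rw [hs', hX.step n x, hs, mul_comm]
  congr 2
  · simp [x, Fin.last]
  · simp [x, Fin.last]

/-- The Markov property of the walk, for the expectation of a bounded function. -/
lemma IsWalk.integral_succ [IsProbabilityMeasure Pr] (hX : IsWalk p X Pr) (n : ℕ)
    {F : (Fin d → ℤ) → ℂ} {C : ℝ} (hF : ∀ x, ‖F x‖ ≤ C) :
    ∫ ω, F (X (n + 1) ω) ∂Pr = ∫ ω, ∫ z, F (X n ω + z) ∂(p (X n ω)).toMeasure ∂Pr := by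
  have hmeas : ∀ G : (Fin d → ℤ) → ℂ, Measurable G := fun G => measurable_of_countable G
  have hp := fun k => Measure.isProbabilityMeasure_map (μ := Pr) (hX.measurable k).aemeasurable
  rw [← integral_map (hX.measurable _).aemeasurable (hmeas _).aestronglyMeasurable, hX.map_succ,
    Measure.comp_eq_comp_const_apply, Kernel.integral_comp, Kernel.const_apply, integral_map (hX.measurable _).aemeasurable
      (hmeas _).aestronglyMeasurable]
  · refine integral_congr_ae (Eventually.of_forall fun ω => ?_)
    simp only
    rw [walkKernel_apply, integral_map (measurable_of_countable _).aemeasurable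
      (hmeas _).aestronglyMeasurable]
  · rw [← Measure.comp_eq_comp_const_apply]
    exact Integrable.of_bound (hmeas _).aestronglyMeasurable C (Eventually.of_forall hF)

end Walk

/-! ### Second-order expansions of characteristic functions. -/

section Expansion

/-- The expansion of the characteristic function of a centred random variable to second order. -/
lemma integral_cexp_isLittleO {S : Type*} [MeasurableSpace S] {m : Measure S}
    [IsProbabilityMeasure m] {D : S → ℝ} (hD : MemLp D 2 m) (h0 : ∫ z, D z ∂m = 0) :
    (fun θ : ℝ => ∫ z, Complex.exp (θ * D z * Complex.I) ∂m -
      (1 - (θ : ℂ) ^ 2 / 2 * (∫ z, D z ^ 2 ∂m : ℝ))) =o[𝓝 0] fun θ : ℝ => θ ^ 2 := by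
  have hm := hD.aestronglyMeasurable.aemeasurable
  have hid : MemLp id 2 (m.map D) := by
    rwa [memLp_map_measure_iff (by fun_prop) hm, Function.id_comp]
  have := Measure.isProbabilityMeasure_map hm
  -- A finite second moment makes the characteristic function `C²`; the Peano remainder needs no
  -- third moment.
  have key : (fun θ : ℝ => charFun (m.map D) θ - taylorWithinEval (charFun (m.map D)) 2 Set.univ 0 θ)
      =o[𝓝 0] fun θ : ℝ => θ ^ 2 := by
    simpa using taylor_isLittleO_univ (x₀ := (0 : ℝ)) (contDiff_charFun hid)
  refine key.congr_left fun θ => ?_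
  rw [taylorWithinEval_charFun_two_zero hm hid, h0, charFun_apply_real,
    integral_map hm (by fun_prop)]
  simp only [Pi.pow_apply]
  push_cast
  ring

/-- Dominated convergence. No rate is needed, since this integral is later multiplied by `θ²/2`. -/
lemma tendsto_integral_cexp_mul {S : Type*} [MeasurableSpace S] {m : Measure S}
    [IsProbabilityMeasure m] {D W : S → ℝ} (hD : AEStronglyMeasurable D m)
    (hW : AEStronglyMeasurable W m) {C : ℝ} (hC : ∀ z, ‖W z‖ ≤ C) :
    Tendsto (fun θ : ℝ => ∫ z, Complex.exp (θ * D z * Complex.I) * W z ∂m) (𝓝 0)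
      (𝓝 ((∫ z, W z ∂m : ℝ) : ℂ)) := by
  rw [← integral_complex_ofReal]
  refine tendsto_integral_filter_of_dominated_convergence (fun _ => C)
    (Eventually.of_forall fun θ => ?_) (Eventually.of_forall fun θ => Eventually.of_forall fun z => ?_)
    (integrable_const C) (Eventually.of_forall fun z => ?_)
  · have h1 : AEMeasurable D m := hD.aemeasurable
    have h2 : AEMeasurable W m := hW.aemeasurable
    exact AEMeasurable.aestronglyMeasurable (by fun_prop)
  · rw [norm_mul, ← Complex.ofReal_mul, Complex.norm_exp_ofReal_mul_I, one_mul, Complex.norm_real]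
    exact hC z
  · have : Continuous fun θ : ℝ => Complex.exp (θ * D z * Complex.I) * W z := by fun_prop
    simpa using this.tendsto 0

/-- The approximate eigenfunction `1 - θ² w / 2` of the perturbed operator: if `w` solves the
Poisson equation for the conditional variances of the increments `D`, then the operator acts on it
as `1 - θ² σ² / 2` up to an error `o(θ²)`. -/
lemma integral_cexp_mul_isLittleO {S : Type*} [MeasurableSpace S] {m : Measure S}
    [IsProbabilityMeasure m] {D W : S → ℝ} (hD : MemLp D 2 m) (h0 : ∫ z, D z ∂m = 0)
    (hW : AEStronglyMeasurable W m) {C : ℝ} (hC : ∀ z, ‖W z‖ ≤ C) {s w : ℝ}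
    (hw : w - ∫ z, W z ∂m = ∫ z, D z ^ 2 ∂m - s) :
    (fun θ : ℝ => ∫ z, Complex.exp (θ * D z * Complex.I) * (1 - (θ : ℂ) ^ 2 / 2 * W z) ∂m -
      (1 - (θ : ℂ) ^ 2 / 2 * s) * (1 - (θ : ℂ) ^ 2 / 2 * w)) =o[𝓝 0] fun θ : ℝ => θ ^ 2 := by
  have hmD : AEMeasurable D m := hD.aestronglyMeasurable.aemeasurable
  have hmW : AEMeasurable W m := hW.aemeasurable
  have e1 := integral_cexp_isLittleO hD h0
  have e2 : (fun θ : ℝ => -((θ : ℂ) ^ 2 / 2) * (∫ z, Complex.exp (θ * D z * Complex.I) * W z ∂m -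
      ((∫ z, W z ∂m : ℝ) : ℂ))) =o[𝓝 0] fun θ : ℝ => θ ^ 2 := by
    have h1 : (fun θ : ℝ => -((θ : ℂ) ^ 2 / 2)) =O[𝓝 0] fun θ : ℝ => θ ^ 2 :=
      Asymptotics.IsBigO.of_bound 1 (Eventually.of_forall fun θ => by
        simp only [norm_neg, norm_div, norm_pow, Complex.norm_real, Complex.norm_ofNat]
        have : 0 ≤ ‖θ‖ ^ 2 := by positivity
        linarith)
    have h2 := (Asymptotics.isLittleO_one_iff ℝ).2 (tendsto_sub_nhds_zero_iff.2
      (tendsto_integral_cexp_mul hD.aestronglyMeasurable hW hC))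
    simpa using h1.mul_isLittleO h2
  -- The fourth-order cross term of the product; the `θ²` terms cancel exactly by `hw`.
  have e3 : (fun θ : ℝ => (-((s * w / 4 : ℝ) : ℂ)) * (θ : ℂ) ^ 4) =o[𝓝 0] fun θ : ℝ => θ ^ 2 := by
    refine Asymptotics.IsLittleO.const_mul_left ?_ _
    have : (fun θ : ℝ => θ ^ 4) =o[𝓝 0] fun θ : ℝ => θ ^ 2 :=
      Asymptotics.isLittleO_pow_pow (by norm_num)
    refine (Asymptotics.isLittleO_norm_left.1 ?_)
    simpa using this.norm_left
  refine ((e1.add e2).add e3).congr_left fun θ => ?_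
  have hi1 : Integrable (fun z => Complex.exp (θ * D z * Complex.I)) m :=
    Integrable.of_bound (AEMeasurable.aestronglyMeasurable (by fun_prop)) 1
      (Eventually.of_forall fun z => by
        rw [← Complex.ofReal_mul, Complex.norm_exp_ofReal_mul_I])
  have hi2 : Integrable (fun z => Complex.exp (θ * D z * Complex.I) * W z) m :=
    Integrable.of_bound (AEMeasurable.aestronglyMeasurable (by fun_prop)) C
      (Eventually.of_forall fun z => by
        rw [norm_mul, ← Complex.ofReal_mul, Complex.norm_exp_ofReal_mul_I, one_mul,
          Complex.norm_real]
        exact hC z)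
  have hsplit : ∫ z, Complex.exp (θ * D z * Complex.I) * (1 - (θ : ℂ) ^ 2 / 2 * W z) ∂m =
      ∫ z, Complex.exp (θ * D z * Complex.I) ∂m -
        (θ : ℂ) ^ 2 / 2 * ∫ z, Complex.exp (θ * D z * Complex.I) * W z ∂m := by
    rw [← integral_const_mul, ← integral_sub hi1 (hi2.const_mul _)]
    congr 1 with z
    ring
  have hs : (s : ℂ) = (∫ z, D z ^ 2 ∂m : ℝ) - (w - (∫ z, W z ∂m : ℝ)) := by
    have : s = (∫ z, D z ^ 2 ∂m) - (w - (∫ z, W z ∂m)) := by linarith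
    exact_mod_cast this
  rw [hsplit]
  push_cast
  rw [hs]
  ring

end Expansion

/-! ### Jump laws on the torus and the Green–Kubo formula. -/

section Jump

variable {d : ℕ} (M : Fin d → ℕ) (p : Environment d)

/-- The law of the jump made from the class `x`. -/
noncomputable def jumpLaw (x : Torus M) : Measure (Fin d → ℤ) := (p (rep M x)).toMeasure

instance (x : Torus M) : IsProbabilityMeasure (jumpLaw M p x) :=
  inferInstanceAs (IsProbabilityMeasure (p (rep M x)).toMeasure)

/-- The class reached from the class `x` by the jump `z`. -/
def target (x : Torus M) (z : Fin d → ℤ) : Torus M := toTorus M (rep M x + z)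

variable {M p}

lemma aestronglyMeasurable_jumpLaw {E : Type*} [TopologicalSpace E]
    [TopologicalSpace.PseudoMetrizableSpace E] (x : Torus M) (f : (Fin d → ℤ) → E) :
    AEStronglyMeasurable f (jumpLaw M p x) :=
  (StronglyMeasurable.of_discrete (f := f)).aestronglyMeasurable

lemma integral_jumpLaw {x : Torus M} {f : (Fin d → ℤ) → ℝ} (hf : Integrable f (jumpLaw M p x)) :
    ∫ z, f z ∂(jumpLaw M p x) = ∑' z, jump M p x z * f z :=
  PMF.integral_eq_tsum _ _ hf

lemma memLp_coord {x : Torus M}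
    (hmom : Summable fun y : Fin d → ℤ => ‖toEuc y‖ ^ 2 * jump M p x y) (i : Fin d) :
    MemLp (fun z : Fin d → ℤ => (z i : ℝ)) 2 (jumpLaw M p x) := by
  refine (memLp_two_iff_integrable_sq (aestronglyMeasurable_jumpLaw x _)).2
    ⟨aestronglyMeasurable_jumpLaw x _, ?_⟩
  rw [HasFiniteIntegral, lintegral_countable']
  refine lt_of_le_of_lt (ENNReal.tsum_le_tsum fun z => ?_) hmom.tsum_ofReal_lt_top
  rw [ENNReal.ofReal_mul (by positivity), jumpLaw,
    PMF.toMeasure_apply_singleton _ _ (measurableSet_singleton _), jump,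
    ENNReal.ofReal_toReal (PMF.apply_ne_top _ _), ← ofReal_norm]
  gcongr
  rw [norm_pow]
  have : ‖(toEuc z) i‖ ≤ ‖toEuc z‖ := PiLp.norm_apply_le _ i
  exact pow_le_pow_left₀ (norm_nonneg _) this 2

lemma jump_nonneg (x : Torus M) (z : Fin d → ℤ) : 0 ≤ jump M p x z := ENNReal.toReal_nonneg

lemma summable_jump (x : Torus M) : Summable (jump M p x) :=
  ENNReal.summable_toReal (by rw [PMF.tsum_coe]; exact ENNReal.one_ne_top)

lemma integrable_mul_of_memLp {S : Type*} [MeasurableSpace S] {m : Measure S} {f g : S → ℝ}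
    (hf : MemLp f 2 m) (hg : MemLp g 2 m) : Integrable (fun z => f z * g z) m :=
  hf.integrable_mul hg

/-- Multiplying by `P` clears the denominator. If `P_{xy} = 0`, every jump from `x` into `y` has
probability zero, so the convention `0 / 0 = 0` is harmless. -/
lemma transition_mul_condMean (x y : Torus M) (i : Fin d) :
    transition M p x y * condMean M p x y i =
      ∑' z, if target M x z = y then (z i : ℝ) * jump M p x z else 0 := by
  rw [condMean]
  by_cases h : transition M p x y = 0
  · rw [h, zero_mul, eq_comm]
    have hs : Summable fun z => if toTorus M (rep M x + z) = y then jump M p x z else 0 :=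
      Summable.of_nonneg_of_le (fun z => by split_ifs <;> simp [jump_nonneg])
        (fun z => by split_ifs <;> simp [jump_nonneg]) (summable_jump (p := p) x)
    have h0 := (hs.hasSum_iff.2 h)
    rw [hasSum_zero_iff_of_nonneg fun z => by
      split_ifs <;> simp [jump_nonneg]] at h0
    refine (tsum_congr fun z => ?_).trans tsum_zero
    have hz := congrFun h0 z
    simp only [Pi.zero_apply] at hz
    by_cases hy : target M x z = y
    · rw [if_pos hy]
      rw [if_pos (show toTorus M (rep M x + z) = y from hy)] at hz
      rw [hz, mul_zero]
    · rw [if_neg hy]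
  · rw [mul_div_cancel₀ _ h]
    rfl

variable [∀ i, NeZero (M i)]

lemma norm_le_sum (c : Torus M → ℝ) (y : Torus M) : ‖c y‖ ≤ ∑ x, ‖c x‖ :=
  Finset.single_le_sum (f := fun x => ‖c x‖) (fun _ _ => norm_nonneg _) (Finset.mem_univ y)

lemma memLp_target (x : Torus M) (c : Torus M → ℝ) :
    MemLp (fun z => c (target M x z)) 2 (jumpLaw M p x) :=
  MemLp.of_bound (aestronglyMeasurable_jumpLaw x _) _
    (Eventually.of_forall fun z => norm_le_sum c (target M x z))

lemma integral_mul_target {x : Torus M} {f : (Fin d → ℤ) → ℝ}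
    (hf : Integrable f (jumpLaw M p x)) (c : Torus M → ℝ) :
    ∫ z, f z * c (target M x z) ∂(jumpLaw M p x) =
      ∑ y, (∑' z, if target M x z = y then f z * jump M p x z else 0) * c y := by
  have hi : ∀ y, Integrable (fun z => f z * if target M x z = y then 1 else 0) (jumpLaw M p x) :=
    fun y => hf.mul_bdd (c := 1) (aestronglyMeasurable_jumpLaw x _)
      (Eventually.of_forall fun z => by split_ifs <;> simp)
  have h1 : ∀ z, f z * c (target M x z) =
      ∑ y, (f z * if target M x z = y then 1 else 0) * c y := fun z => by simp
  simp_rw [h1]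
  rw [integral_finsetSum _ fun y _ => (hi y).mul_const _]
  refine Finset.sum_congr rfl fun y _ => ?_
  rw [integral_mul_const, integral_jumpLaw (hi y)]
  congr 1
  refine tsum_congr fun z => ?_
  split_ifs <;> ring

lemma transition_mulVec (x : Torus M) (c : Torus M → ℝ) :
    (transition M p *ᵥ c) x = ∫ z, c (target M x z) ∂(jumpLaw M p x) := by
  have := integral_mul_target (p := p) (x := x) (integrable_const (1 : ℝ)) c
  simp only [one_mul] at this
  rw [this]
  rfl

lemma transition_mulVec_one : transition M p *ᵥ 1 = 1 := by
  ext x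
  rw [transition_mulVec]
  simp

section Moments

variable (hmom : ∀ x : Torus M, Summable fun y : Fin d → ℤ => ‖toEuc y‖ ^ 2 * jump M p x y)
include hmom

/-- In `Σ` the conditional means always appear multiplied by `P`, so conditioning on the target
class can be undone, leaving integrals over the jump law. -/
lemma sum_transition_mul_condMean_sub (x : Torus M) (i : Fin d) (a : ℝ) (c : Torus M → ℝ) :
    ∑ y, transition M p x y * (condMean M p x y i - a) * c y =
      ∫ z, ((z i : ℝ) - a) * c (target M x z) ∂(jumpLaw M p x) := by
  have h1 : Integrable (fun z : Fin d → ℤ => (z i : ℝ)) (jumpLaw M p x) :=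
    (memLp_coord (hmom x) i).integrable one_le_two
  have hc := memLp_target (p := p) x c
  have e1 := integral_mul_target h1 c
  have e2 := transition_mulVec (p := p) x c
  simp only [Matrix.mulVec, dotProduct] at e2
  simp_rw [← transition_mul_condMean] at e1
  simp only [sub_mul, mul_sub]
  rw [integral_sub (integrable_mul_of_memLp (memLp_coord (hmom x) i) hc)
    ((hc.integrable one_le_two).const_mul a), e1, integral_const_mul, ← e2, Finset.mul_sum,
    ← Finset.sum_sub_distrib]
  exact Finset.sum_congr rfl fun y _ => by ring

lemma velocity_apply (π : Torus M → ℝ) (i : Fin d) :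
    velocity M p π i = ∑ x, π x * ∫ z, (z i : ℝ) ∂(jumpLaw M p x) := by
  rw [velocity]
  simp only
  refine Finset.sum_congr rfl fun x _ => ?_
  rw [integral_jumpLaw ((memLp_coord (hmom x) i).integrable one_le_two)]

/-- The expected excess of a jump over the asymptotic velocity. -/
lemma sum_transition_condMean_sub (π : Torus M → ℝ) (x : Torus M) (i : Fin d) :
    ∑ y, transition M p x y * (condMean M p x y i - velocity M p π i) =
      ∫ z, ((z i : ℝ) - velocity M p π i) ∂(jumpLaw M p x) := by
  simpa using sum_transition_mul_condMean_sub hmom x i (velocity M p π i) 1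

lemma drift_mem_meanZero {π : Torus M → ℝ} (hπ : IsStationary (transition M p) π) (j : Fin d) :
    (fun z => ∑ w, transition M p z w * (condMean M p z w j - velocity M p π j)) ∈
      meanZero π := by
  rw [meanZero, Set.mem_ofPred_eq, dotProduct]
  simp_rw [sum_transition_condMean_sub hmom]
  have : ∀ x, ∫ z : Fin d → ℤ, ((z j : ℝ) - velocity M p π j) ∂(jumpLaw M p x) =
      ∫ z : Fin d → ℤ, (z j : ℝ) ∂(jumpLaw M p x) - velocity M p π j := fun x => by
    rw [integral_sub ((memLp_coord (hmom x) j).integrable one_le_two) (integrable_const _)]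
    simp
  simp_rw [this, mul_sub, Finset.sum_sub_distrib, ← Finset.sum_mul, hπ.2.1, one_mul]
  rw [velocity_apply hmom, sub_self]

end Moments

variable (M p) in
/-- The solution `(I - P)⁻¹ f_j` of the Poisson equation for the drift. -/
noncomputable def corrector (π : Torus M → ℝ) (j : Fin d) : Torus M → ℝ :=
  invOneSub (transition M p) π
    (fun z => ∑ w, transition M p z w * (condMean M p z w j - velocity M p π j))

variable (M p) in
/-- The increment of the corrected walk, which is a martingale. -/
noncomputable def increment (π : Torus M → ℝ) (i : Fin d) (x : Torus M) (z : Fin d → ℤ) : ℝ :=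
  (z i : ℝ) - velocity M p π i + corrector M p π i (target M x z) - corrector M p π i x

section Martingale

variable (hmom : ∀ x : Torus M, Summable fun y : Fin d → ℤ => ‖toEuc y‖ ^ 2 * jump M p x y)
  {π : Torus M → ℝ}
include hmom

lemma memLp_coord_sub (x : Torus M) (i : Fin d) :
    MemLp (fun z : Fin d → ℤ => (z i : ℝ) - velocity M p π i) 2 (jumpLaw M p x) :=
  (memLp_coord (hmom x) i).sub (memLp_const _)

lemma memLp_coord_sub_add (x : Torus M) (i : Fin d) (c : Torus M → ℝ) :
    MemLp (fun z : Fin d → ℤ => (z i : ℝ) - velocity M p π i + c (target M x z)) 2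
      (jumpLaw M p x) :=
  (memLp_coord_sub hmom x i).add (memLp_target x _)

lemma memLp_increment (x : Torus M) (i : Fin d) :
    MemLp (increment M p π i x) 2 (jumpLaw M p x) :=
  (memLp_coord_sub_add hmom x i _).sub (memLp_const _)

lemma covOne_eq (i j : Fin d) :
    covOne M p π i j = ∑ x, π x * ∫ z, ((z i : ℝ) - velocity M p π i) *
      ((z j : ℝ) - velocity M p π j) ∂(jumpLaw M p x) := by
  rw [covOne]
  refine Finset.sum_congr rfl fun x _ => ?_
  rw [integral_jumpLaw
    (integrable_mul_of_memLp (memLp_coord_sub hmom x i) (memLp_coord_sub hmom x j))]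
  simp only [mul_assoc]

lemma covLag_eq (i j : Fin d) :
    covLag M p π i j = ∑ x, π x * ∫ z, ((z i : ℝ) - velocity M p π i) *
      corrector M p π j (target M x z) ∂(jumpLaw M p x) := by
  rw [covLag]
  refine Finset.sum_congr rfl fun x _ => ?_
  rw [← sum_transition_mul_condMean_sub hmom x i _ (corrector M p π j), Finset.mul_sum]
  exact Finset.sum_congr rfl fun y _ => by rw [corrector]; ring

variable (hirr : (transition M p).IsIrreducible) (hπ : IsStationary (transition M p) π)
include hirr hπ

/-- The Poisson equation `h - P h = f`, read as drift plus `P h` equals `h`. -/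
lemma integral_coord_sub_add_corrector (x : Torus M) (i : Fin d) :
    ∫ z, ((z i : ℝ) - velocity M p π i + corrector M p π i (target M x z)) ∂(jumpLaw M p x) =
      corrector M p π i x := by
  have h := congrFun (invOneSub_spec hirr transition_mulVec_one hπ
    (drift_mem_meanZero hmom hπ i)) x
  rw [← corrector, Pi.sub_apply, transition_mulVec, sum_transition_condMean_sub hmom] at h
  rw [integral_add ((memLp_coord_sub hmom x i).integrable one_le_two)
    ((memLp_target x _).integrable one_le_two)]
  linarith

lemma integral_increment (x : Torus M) (i : Fin d) :
    ∫ z, increment M p π i x z ∂(jumpLaw M p x) = 0 := by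
  simp only [increment]
  rw [integral_sub ((memLp_coord_sub_add hmom x i _).integrable one_le_two)
    (integrable_const _), integral_coord_sub_add_corrector hmom hirr hπ]
  simp

/-- The Green–Kubo covariance is the stationary covariance of the martingale increments. -/
lemma asympCov_eq (i j : Fin d) :
    asympCov M p π i j =
      ∑ x, π x * ∫ z, increment M p π i x z * increment M p π j x z ∂(jumpLaw M p x) := by
  set h := corrector M p π with hh
  -- Each increment is a variable of mean `h(x)` minus that mean, so the terms linear in `h(x)`
  -- collapse to `-h_i(x) h_j(x)`.
  have key : ∀ x, ∫ z, increment M p π i x z * increment M p π j x z ∂(jumpLaw M p x) =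
      ∫ z, ((z i : ℝ) - velocity M p π i) * ((z j : ℝ) - velocity M p π j) ∂(jumpLaw M p x) +
      (∫ z, ((z i : ℝ) - velocity M p π i) * h j (target M x z) ∂(jumpLaw M p x) +
        ∫ z, ((z j : ℝ) - velocity M p π j) * h i (target M x z) ∂(jumpLaw M p x)) +
      ((transition M p *ᵥ (h i * h j)) x - h i x * h j x) := fun x => by
    have ai := memLp_coord_sub (π := π) hmom x i
    have aj := memLp_coord_sub (π := π) hmom x j
    have bi := memLp_target (p := p) x (h i)
    have bj := memLp_target (p := p) x (h j)
    have si := integral_coord_sub_add_corrector hmom hirr hπ x i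
    have sj := integral_coord_sub_add_corrector hmom hirr hπ x j
    rw [transition_mulVec]
    have I1 := integrable_mul_of_memLp ai aj
    have I2 := integrable_mul_of_memLp ai bj
    have I3 := integrable_mul_of_memLp aj bi
    have I4 := integrable_mul_of_memLp bi bj
    have I5 := ((memLp_coord_sub_add (π := π) hmom x i (h i)).integrable one_le_two).const_mul
      (-h j x)
    have I6 := ((memLp_coord_sub_add (π := π) hmom x j (h j)).integrable one_le_two).const_mul
      (-h i x)
    have I12 := I1.fun_add I2
    have I123 := I12.fun_add I3
    have I1234 := I123.fun_add I4
    have I15 := I1234.fun_add I5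
    have I16 := I15.fun_add I6
    have e : ∀ z, increment M p π i x z * increment M p π j x z =
        ((z i : ℝ) - velocity M p π i) * ((z j : ℝ) - velocity M p π j) +
        ((z i : ℝ) - velocity M p π i) * h j (target M x z) +
        ((z j : ℝ) - velocity M p π j) * h i (target M x z) +
        h i (target M x z) * h j (target M x z) +
        -h j x * ((z i : ℝ) - velocity M p π i + h i (target M x z)) +
        -h i x * ((z j : ℝ) - velocity M p π j + h j (target M x z)) + h i x * h j x := fun z => by
      simp only [increment, hh]
      ring
    simp_rw [e]
    rw [integral_add I16 (integrable_const _), integral_add I15 I6, integral_add I1234 I5,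
      integral_add I123 I4, integral_add I12 I3, integral_add I1 I2,
      integral_const_mul, integral_const_mul, si, sj]
    simp only [integral_const, probReal_univ, one_smul, Pi.mul_apply]
    ring
  -- Stationarity removes the only terms absent from the Green–Kubo formula.
  have hst : ∑ x, π x * ((transition M p *ᵥ (h i * h j)) x - h i x * h j x) = 0 := by
    have := hπ.dotProduct_mulVec (h i * h j)
    simp only [dotProduct, Pi.mul_apply] at this
    simp_rw [mul_sub, Finset.sum_sub_distrib]
    exact sub_eq_zero.2 this
  rw [asympCov, covOne_eq hmom, covLag_eq hmom, covLag_eq hmom]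
  simp_rw [key, mul_add, Finset.sum_add_distrib]
  rw [hst, add_zero]

/-- The quadratic form of the Green–Kubo covariance matrix. -/
lemma dotProduct_asympCov (u : Fin d → ℝ) :
    u ⬝ᵥ asympCov M p π *ᵥ u =
      ∑ x, π x * ∫ z, (∑ i, u i * increment M p π i x z) ^ 2 ∂(jumpLaw M p x) := by
  have key : ∀ x, ∫ z, (∑ i, u i * increment M p π i x z) ^ 2 ∂(jumpLaw M p x) =
      ∑ i, ∑ j, u i * u j *
        ∫ z, increment M p π i x z * increment M p π j x z ∂(jumpLaw M p x) := fun x => by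
    have hI : ∀ i j, Integrable (fun z => u i * u j *
        (increment M p π i x z * increment M p π j x z)) (jumpLaw M p x) := fun i j =>
      ((memLp_increment hmom x i).integrable_mul (memLp_increment hmom x j)).const_mul _
    have e : ∀ z, (∑ i, u i * increment M p π i x z) ^ 2 =
        ∑ i, ∑ j, u i * u j * (increment M p π i x z * increment M p π j x z) := fun z => by
      rw [sq, Finset.sum_mul_sum]
      exact Finset.sum_congr rfl fun i _ => Finset.sum_congr rfl fun j _ => by ring
    simp_rw [e]
    rw [integral_finsetSum _ fun i _ => integrable_finsetSum _ fun j _ => hI i j]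
    refine Finset.sum_congr rfl fun i _ => ?_
    rw [integral_finsetSum _ fun j _ => hI i j]
    exact Finset.sum_congr rfl fun j _ => integral_const_mul _ _
  simp_rw [key, dotProduct, Matrix.mulVec, dotProduct, asympCov_eq hmom hirr hπ, Finset.mul_sum,
    Finset.sum_mul, Finset.mul_sum]
  calc _ = ∑ i, ∑ x, ∑ j, _ := Finset.sum_congr rfl fun i _ => Finset.sum_comm
    _ = ∑ x, ∑ i, ∑ j, _ := Finset.sum_comm
    _ = _ := ?_
  exact Finset.sum_congr rfl fun x _ => Finset.sum_congr rfl fun i _ =>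
    Finset.sum_congr rfl fun j _ => by ring

theorem posSemidef_asympCov : (asympCov M p π).PosSemidef := by
  refine Matrix.PosSemidef.of_dotProduct_mulVec_nonneg ?_ fun u => ?_
  · ext i j
    simp only [Matrix.conjTranspose_apply, star_trivial, asympCov_eq hmom hirr hπ, mul_comm]
  · rw [star_trivial, dotProduct_asympCov hmom hirr hπ]
    exact Finset.sum_nonneg fun x _ => mul_nonneg (hπ.1 x)
      (integral_nonneg fun z => sq_nonneg _)

end Martingale

end Jump

/-! ### Periodicity and iteration of the approximate eigenfunction. -/

section CharFun

variable {d : ℕ} {M : Fin d → ℕ} {p : Environment d}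

lemma IsPeriodic.add_single_mul (hper : IsPeriodic M p) (i : Fin d) (k : ℤ) (x : Fin d → ℤ) :
    p (x + Pi.single i (k * M i)) = p x := by
  induction k using Int.induction_on with
  | zero => simp
  | succ k ih =>
    rw [add_mul, one_mul, Pi.single_add, ← add_assoc, hper, ih]
  | pred k ih =>
    rw [← hper i, add_assoc, ← Pi.single_add, sub_mul, one_mul, sub_add_cancel, ih]

lemma IsPeriodic.add_mul (hper : IsPeriodic M p) (k x : Fin d → ℤ) :
    p (x + fun i => k i * M i) = p x := by
  have key : ∀ s : Finset (Fin d), p (x + ∑ i ∈ s, Pi.single i (k i * M i)) = p x := fun s => by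
    induction s using Finset.induction_on with
    | empty => simp
    | insert i s hi ih =>
      rw [Finset.sum_insert hi, add_comm (Pi.single i _), ← add_assoc, hper.add_single_mul, ih]
  rw [← key Finset.univ, Finset.univ_sum_single]

variable [∀ i, NeZero (M i)]

lemma exists_eq_rep_add (x : Fin d → ℤ) :
    ∃ k : Fin d → ℤ, x = rep M (toTorus M x) + fun i => k i * M i := by
  refine ⟨fun i => x i / M i, funext fun i => ?_⟩
  simp only [Pi.add_apply, rep, toTorus]
  rw [ZMod.val_intCast]
  exact (Int.emod_add_ediv_mul (x i) (M i)).symm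

lemma IsPeriodic.apply_rep (hper : IsPeriodic M p) (x : Fin d → ℤ) :
    p (rep M (toTorus M x)) = p x := by
  obtain ⟨k, hk⟩ := exists_eq_rep_add (M := M) x
  conv_rhs => rw [hk]
  rw [hper.add_mul]

omit [∀ i, NeZero (M i)] in
lemma toTorus_add (x z : Fin d → ℤ) : toTorus M (x + z) = toTorus M x + toTorus M z := by
  ext i
  simp [toTorus]

lemma toTorus_rep (x : Torus M) : toTorus M (rep M x) = x := by
  ext i
  simp [toTorus, rep]

lemma toTorus_add_eq_target (x z : Fin d → ℤ) :
    toTorus M (x + z) = target M (toTorus M x) z := by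
  rw [target, toTorus_add, toTorus_add, toTorus_rep]

/-- The pairing of `u` with the displacement `y` centred at velocity `v`, up to time `n`. -/
def centred (u v : Fin d → ℝ) (n : ℕ) (y : Fin d → ℤ) : ℝ := ∑ i, u i * ((y i : ℝ) - n * v i)

lemma centred_succ_add (u v : Fin d → ℝ) (n : ℕ) (y z : Fin d → ℤ) :
    centred u v (n + 1) (y + z) = centred u v n y + ∑ i, u i * ((z i : ℝ) - v i) := by
  rw [centred, centred, ← Finset.sum_add_distrib]
  refine Finset.sum_congr rfl fun i _ => ?_
  push_cast [Pi.add_apply]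
  ring

variable {Ω : Type*} [MeasurableSpace Ω] {Pr : Measure Ω} [IsProbabilityMeasure Pr]
  {X : ℕ → Ω → (Fin d → ℤ)}

/-- The factor by which the corrected test function differs from the plain exponential. -/
noncomputable def correction (g w : Torus M → ℝ) (θ : ℝ) (x : Torus M) : ℂ :=
  Complex.exp (θ * g x * Complex.I) * (1 - (θ : ℂ) ^ 2 / 2 * w x)

lemma tendsto_sum_norm_correction_sub_one (g w : Torus M → ℝ) :
    Tendsto (fun θ : ℝ => ∑ x, ‖correction g w θ x - 1‖) (𝓝 0) (𝓝 0) := by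
  have : Continuous fun θ : ℝ => ∑ x, ‖correction g w θ x - 1‖ := by
    unfold correction
    fun_prop
  simpa [correction] using this.tendsto 0

lemma integrable_comp_walk (hX : IsWalk p X Pr) (n : ℕ) {F : (Fin d → ℤ) → ℂ} {C : ℝ}
    (hF : ∀ y, ‖F y‖ ≤ C) : Integrable (fun ω => F (X n ω)) Pr :=
  Integrable.of_bound
    ((measurable_of_countable F).comp (hX.measurable n)).aestronglyMeasurable C
    (Eventually.of_forall fun ω => hF (X n ω))

lemma norm_cexp_mul (θ a : ℝ) : ‖Complex.exp (θ * a * Complex.I)‖ = 1 := by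
  rw [← Complex.ofReal_mul, Complex.norm_exp_ofReal_mul_I]

/-- The error made by one step of the walk, when the corrected test function is treated as an
eigenfunction. -/
noncomputable def stepError (p : Environment d) (D : Torus M → (Fin d → ℤ) → ℝ) (w : Torus M → ℝ)
    (s θ : ℝ) (x : Torus M) : ℂ :=
  ∫ z, Complex.exp (θ * D x z * Complex.I) * (1 - (θ : ℂ) ^ 2 / 2 * w (target M x z))
      ∂(jumpLaw M p x) - (1 - (θ : ℂ) ^ 2 / 2 * s) * (1 - (θ : ℂ) ^ 2 / 2 * w x)

lemma norm_correction_le (g w : Torus M → ℝ) (θ : ℝ) (x : Torus M) :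
    ‖correction g w θ x‖ ≤ ∑ y, ‖correction g w θ y‖ :=
  Finset.single_le_sum (f := fun y => ‖correction g w θ y‖) (fun _ _ => norm_nonneg _)
    (Finset.mem_univ x)

variable (hper : IsPeriodic M p) (hX : IsWalk p X Pr)
include hX

/-- The exponential has modulus one, so the cost of inserting the correction is uniform in `n`. This
is used both at time `0` and at time `n`. -/
lemma norm_integral_correction_sub_le (u v : Fin d → ℝ) (g w : Torus M → ℝ) (θ : ℝ) (n : ℕ) :
    ‖∫ ω, Complex.exp (θ * centred u v n (X n ω) * Complex.I) *
        correction g w θ (toTorus M (X n ω)) ∂Pr -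
      ∫ ω, Complex.exp (θ * centred u v n (X n ω) * Complex.I) ∂Pr‖ ≤
    ∑ x, ‖correction g w θ x - 1‖ := by
  have h1 : Integrable (fun ω => Complex.exp (θ * centred u v n (X n ω) * Complex.I) *
      correction g w θ (toTorus M (X n ω))) Pr :=
    integrable_comp_walk hX n (F := fun y => Complex.exp (θ * centred u v n y * Complex.I) *
      correction g w θ (toTorus M y)) (C := ∑ x, ‖correction g w θ x‖) fun y => by
        rw [norm_mul, norm_cexp_mul, one_mul]
        exact norm_correction_le g w θ _
  have h2 : Integrable (fun ω => Complex.exp (θ * centred u v n (X n ω) * Complex.I)) Pr :=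
    integrable_comp_walk hX n (F := fun y => Complex.exp (θ * centred u v n y * Complex.I))
      (C := 1) fun y => (norm_cexp_mul _ _).le
  rw [← integral_sub h1 h2]
  refine (norm_integral_le_of_norm_le_const (C := ∑ x, ‖correction g w θ x - 1‖)
    (Eventually.of_forall fun ω => ?_)).trans_eq (by simp)
  rw [← mul_sub_one, norm_mul, norm_cexp_mul, one_mul]
  exact Finset.single_le_sum (f := fun y => ‖correction g w θ y - 1‖) (fun _ _ => norm_nonneg _)
    (Finset.mem_univ _)

include hper

/-- Given the current site, the new corrected phase is the old one plus `θ D`. The conditional error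
is thus a unimodular factor times `stepError`, which depends only on the class by periodicity. -/
lemma norm_integral_step_le (u v : Fin d → ℝ) (g w : Torus M → ℝ)
    {D : Torus M → (Fin d → ℤ) → ℝ}
    (hD : ∀ x z, D x z = ∑ i, u i * ((z i : ℝ) - v i) + g (target M x z) - g x)
    (s θ : ℝ) (n : ℕ) :
    ‖∫ ω, Complex.exp (θ * centred u v (n + 1) (X (n + 1) ω) * Complex.I) *
        correction g w θ (toTorus M (X (n + 1) ω)) ∂Pr -
      (1 - (θ : ℂ) ^ 2 / 2 * s) * ∫ ω, Complex.exp (θ * centred u v n (X n ω) * Complex.I) *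
        correction g w θ (toTorus M (X n ω)) ∂Pr‖ ≤ ∑ x, ‖stepError p D w s θ x‖ := by
  set F : ℕ → (Fin d → ℤ) → ℂ := fun n y => Complex.exp (θ * centred u v n y * Complex.I) *
    correction g w θ (toTorus M y) with hF
  have hFle : ∀ n y, ‖F n y‖ ≤ ∑ x, ‖correction g w θ x‖ := fun n y => by
    rw [hF, norm_mul, norm_cexp_mul, one_mul]
    exact norm_correction_le g w θ _
  have hpt : ∀ y, ∫ z, F (n + 1) (y + z) ∂(p y).toMeasure - (1 - (θ : ℂ) ^ 2 / 2 * s) * F n y =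
      Complex.exp (θ * (centred u v n y + g (toTorus M y) : ℝ) * Complex.I) *
        stepError p D w s θ (toTorus M y) := fun y => by
    have e : ∀ z, F (n + 1) (y + z) =
        Complex.exp (θ * (centred u v n y + g (toTorus M y) : ℝ) * Complex.I) *
        (Complex.exp (θ * D (toTorus M y) z * Complex.I) *
          (1 - (θ : ℂ) ^ 2 / 2 * w (target M (toTorus M y) z))) := fun z => by
      simp only [hF, correction, centred_succ_add, toTorus_add_eq_target, hD, ← mul_assoc,
        ← Complex.exp_add]
      congr 2
      push_cast
      ring
    simp_rw [e]
    rw [integral_const_mul, stepError, jumpLaw, hper.apply_rep, mul_sub]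
    congr 1
    simp only [hF, correction]
    rw [Complex.ofReal_add, mul_add, add_mul, Complex.exp_add]
    ring
  have hi : Integrable (fun ω => ∫ z, F (n + 1) (X n ω + z) ∂(p (X n ω)).toMeasure) Pr :=
    integrable_comp_walk hX n (F := fun y => ∫ z, F (n + 1) (y + z) ∂(p y).toMeasure)
      (C := ∑ x, ‖correction g w θ x‖) fun y => (norm_integral_le_of_norm_le_const
        (Eventually.of_forall fun z => hFle _ (y + z))).trans_eq (by simp)
  have hi' : Integrable (fun ω => F n (X n ω)) Pr := integrable_comp_walk hX n (hFle n)
  rw [hX.integral_succ n (F := F (n + 1)) (hFle (n + 1)), ← integral_const_mul,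
    ← integral_sub hi (hi'.const_mul _)]
  refine (norm_integral_le_of_norm_le_const (C := ∑ x, ‖stepError p D w s θ x‖)
    (Eventually.of_forall fun ω => ?_)).trans_eq (by simp)
  rw [hpt, norm_mul, norm_cexp_mul, one_mul]
  exact Finset.single_le_sum (f := fun y => ‖stepError p D w s θ y‖) (fun _ _ => norm_nonneg _)
    (Finset.mem_univ _)

-- Since `‖q‖ ≤ 1`, earlier errors are not amplified and simply add up.
omit hX hper in
lemma norm_sub_pow_mul_le {A : ℕ → ℂ} {q : ℂ} (hq : ‖q‖ ≤ 1) {ε : ℝ}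
    (h : ∀ n, ‖A (n + 1) - q * A n‖ ≤ ε) (n : ℕ) : ‖A n - q ^ n * A 0‖ ≤ n * ε := by
  induction n with
  | zero => simp
  | succ n ih =>
    have e : A (n + 1) - q ^ (n + 1) * A 0 = (A (n + 1) - q * A n) + q * (A n - q ^ n * A 0) := by
      ring
    rw [e]
    refine (norm_add_le _ _).trans ?_
    have : ‖q * (A n - q ^ n * A 0)‖ ≤ n * ε := by
      rw [norm_mul]
      exact (mul_le_of_le_one_left (norm_nonneg _) hq).trans ih
    push_cast
    linarith [h n]

/-- The characteristic function of the centred walk in the direction `u`, scaled by `√n`, converges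
to the Gaussian one. -/
theorem tendsto_integral_cexp_centred (u v : Fin d → ℝ) (g w : Torus M → ℝ)
    {D : Torus M → (Fin d → ℤ) → ℝ}
    (hD : ∀ x z, D x z = ∑ i, u i * ((z i : ℝ) - v i) + g (target M x z) - g x)
    (hD2 : ∀ x, MemLp (D x) 2 (jumpLaw M p x)) (hD0 : ∀ x, ∫ z, D x z ∂(jumpLaw M p x) = 0)
    {s : ℝ} (hs : 0 ≤ s)
    (hw : ∀ x, w x - ∫ z, w (target M x z) ∂(jumpLaw M p x) =
      ∫ z, D x z ^ 2 ∂(jumpLaw M p x) - s) :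
    Tendsto (fun n : ℕ => ∫ ω, Complex.exp ((((√(n : ℝ))⁻¹ : ℝ) : ℂ) *
      centred u v n (X n ω) * Complex.I) ∂Pr) atTop (𝓝 (Complex.exp (-s / 2))) := by
  set θ : ℕ → ℝ := fun n => (√(n : ℝ))⁻¹ with hθ
  have hθ0 : Tendsto θ atTop (𝓝 0) :=
    tendsto_inv_atTop_zero.comp (Real.tendsto_sqrt_atTop.comp tendsto_natCast_atTop_atTop)
  -- Valid at `n = 0` too, where both sides are `0`.
  have hθsq : ∀ n, θ n ^ 2 = (n : ℝ)⁻¹ := fun n => by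
    rw [hθ, inv_pow, Real.sq_sqrt n.cast_nonneg]
  set B : ℕ → ℂ := fun n => ∫ ω, Complex.exp (θ n * centred u v n (X n ω) * Complex.I) ∂Pr
  set A : ℝ → ℕ → ℂ := fun t n => ∫ ω, Complex.exp (t * centred u v n (X n ω) * Complex.I) *
        correction g w t (toTorus M (X n ω)) ∂Pr with hA
  set q : ℕ → ℂ := fun n => 1 - (θ n : ℂ) ^ 2 / 2 * s with hq
  have hη := (tendsto_sum_norm_correction_sub_one g w).comp hθ0
  have hρ : (fun t : ℝ => ∑ x, ‖stepError p D w s t x‖) =o[𝓝 0] fun t : ℝ => t ^ 2 := by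
    refine Asymptotics.IsLittleO.fun_sum fun x _ => Asymptotics.IsLittleO.norm_left ?_
    exact integral_cexp_mul_isLittleO (hD2 x) (hD0 x) (aestronglyMeasurable_jumpLaw x _)
      (fun z => norm_le_sum w _) (hw x)
  have hρ' : Tendsto (fun n : ℕ => n * ∑ x, ‖stepError p D w s (θ n) x‖) atTop (𝓝 0) := by
    refine (hρ.comp_tendsto hθ0).tendsto_div_nhds_zero.congr fun n => ?_
    simp only [Function.comp_apply, hθsq]
    rw [div_inv_eq_mul, mul_comm]
  have hqreal : ∀ n, q n = ((1 - θ n ^ 2 / 2 * s : ℝ) : ℂ) := fun n => by simp [hq]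
  -- The upper bound uses `s ≥ 0`; large `n` keeps `q n` positive.
  have hq1 : ∀ᶠ n in atTop, ‖q n‖ ≤ 1 := by
    have h1 : Tendsto (fun n => 1 - θ n ^ 2 / 2 * s) atTop (𝓝 1) := by
      simpa using (((hθ0.pow 2).div_const 2).mul_const s).const_sub 1
    filter_upwards [h1.eventually (lt_mem_nhds one_pos)] with n hn
    rw [hqreal, Complex.norm_real, Real.norm_of_nonneg hn.le]
    have : 0 ≤ θ n ^ 2 / 2 * s := by positivity
    linarith
  have hqpow : Tendsto (fun n => q n ^ n) atTop (𝓝 (Complex.exp (-s / 2))) := by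
    have h1 := (Complex.continuous_ofReal.tendsto _).comp
      (Real.tendsto_one_add_div_pow_exp (-s / 2))
    have h2 : ((Real.exp (-s / 2) : ℝ) : ℂ) = Complex.exp (-s / 2) := by push_cast; rfl
    rw [h2] at h1
    refine h1.congr fun n => ?_
    rw [hqreal, hθsq, Function.comp_apply, Complex.ofReal_pow]
    congr 2
    ring
  have hA0 : ∀ n, ‖A (θ n) 0 - 1‖ ≤ ∑ x, ‖correction g w (θ n) x - 1‖ := fun n => by
    have h1 : ∫ ω, Complex.exp (θ n * centred u v 0 (X 0 ω) * Complex.I) ∂Pr = 1 := by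
      rw [integral_congr_ae (g := fun _ => (1 : ℂ)) (by
        filter_upwards [hX.start] with ω hω
        rw [hω]
        simp [centred])]
      simp
    have := norm_integral_correction_sub_le hX u v g w (θ n) 0
    rwa [h1] at this
  have e1 : Tendsto (fun n => A (θ n) n - B n) atTop (𝓝 0) :=
    squeeze_zero_norm (fun n => norm_integral_correction_sub_le hX u v g w (θ n) n) hη
  have e2 : Tendsto (fun n => A (θ n) n - q n ^ n * A (θ n) 0) atTop (𝓝 0) := by
    refine squeeze_zero_norm' ?_ hρ'
    filter_upwards [hq1] with n hn
    exact norm_sub_pow_mul_le hn (fun k => norm_integral_step_le hper hX u v g w hD s (θ n) k) n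
  have e3 : Tendsto (fun n => A (θ n) 0) atTop (𝓝 1) :=
    tendsto_sub_nhds_zero_iff.1 (squeeze_zero_norm hA0 hη)
  -- `B n = (A (θ n) n - q n ^ n * A (θ n) 0) - (A (θ n) n - B n) + q n ^ n * A (θ n) 0`.
  have := (e2.sub e1).add (hqpow.mul e3)
  rw [sub_zero, zero_add, mul_one] at this
  exact this.congr fun n => by ring

end CharFun

/-! ### The central limit theorem. -/

section CentralLimit

variable {d : ℕ} {M : Fin d → ℕ} [∀ i, NeZero (M i)] {p : Environment d}
  {Ω : Type*} [MeasurableSpace Ω] {Pr : Measure Ω} [IsProbabilityMeasure Pr]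
  {X : ℕ → Ω → (Fin d → ℤ)} {π : Torus M → ℝ}

/-- Here `g` is the corrector along `u`, and `w` solves the second Poisson equation, whose right
side `V` is the conditional variance minus `s`. It is solvable because `s` is the `π`-average of the
conditional variances. -/
lemma tendsto_integral_cexp_velocity (hper : IsPeriodic M p) (hX : IsWalk p X Pr)
    (hirr : (transition M p).IsIrreducible)
    (hmom : ∀ x : Torus M, Summable fun y : Fin d → ℤ => ‖toEuc y‖ ^ 2 * jump M p x y)
    (hπ : IsStationary (transition M p) π) (u : Fin d → ℝ) :
    Tendsto (fun n : ℕ => ∫ ω, Complex.exp ((((√(n : ℝ))⁻¹ : ℝ) : ℂ) *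
      centred u (velocity M p π) n (X n ω) * Complex.I) ∂Pr) atTop
      (𝓝 (Complex.exp (-(u ⬝ᵥ asympCov M p π *ᵥ u : ℝ) / 2))) := by
  have hLp : ∀ x, MemLp (fun z => ∑ i, u i * increment M p π i x z) 2 (jumpLaw M p x) := fun x =>
    memLp_finsetSum _ fun i _ => (memLp_increment hmom x i).const_mul (u i)
  set s := u ⬝ᵥ asympCov M p π *ᵥ u with hs
  set V : Torus M → ℝ := fun x =>
    ∫ z, (∑ i, u i * increment M p π i x z) ^ 2 ∂(jumpLaw M p x) - s with hV
  have hVmean : V ∈ meanZero π := by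
    rw [meanZero, Set.mem_ofPred_eq, dotProduct]
    simp_rw [hV, mul_sub, Finset.sum_sub_distrib, ← Finset.sum_mul, hπ.2.1, one_mul]
    rw [hs, dotProduct_asympCov hmom hirr hπ, sub_self]
  refine tendsto_integral_cexp_centred hper hX u _ (fun x => ∑ i, u i * corrector M p π i x)
    (invOneSub (transition M p) π V) (D := fun x z => ∑ i, u i * increment M p π i x z)
    (fun x z => ?_) hLp (fun x => ?_) ?_ (fun x => ?_)
  · rw [← Finset.sum_add_distrib, ← Finset.sum_sub_distrib]
    exact Finset.sum_congr rfl fun i _ => by rw [increment]; ring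
  · rw [integral_finsetSum _ fun i _ =>
      ((memLp_increment hmom x i).integrable one_le_two).const_mul (u i)]
    simp_rw [integral_const_mul, integral_increment hmom hirr hπ, mul_zero, Finset.sum_const_zero]
  · simpa using (posSemidef_asympCov hmom hirr hπ).dotProduct_mulVec_nonneg u
  · rw [← transition_mulVec]
    exact congrFun (invOneSub_spec hirr transition_mulVec_one hπ hVmean) x

/-- The central limit theorem for the walk in a periodic environment. -/
theorem tendstoInDistribution_walk (hper : IsPeriodic M p) (hX : IsWalk p X Pr)
    (hirr : (transition M p).IsIrreducible)
    (hmom : ∀ x : Torus M, Summable fun y : Fin d → ℤ => ‖toEuc y‖ ^ 2 * jump M p x y)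
    (hπ : IsStationary (transition M p) π) :
    TendstoInDistribution
      (fun (n : ℕ) (ω : Ω) => (√(n : ℝ))⁻¹ • (toEuc (X n ω) - (n : ℝ) • velocity M p π))
      atTop (id : EuclideanSpace ℝ (Fin d) → EuclideanSpace ℝ (Fin d)) (fun _ => Pr)
      (multivariateGaussian 0 (asympCov M p π)) := by
  have hmeas : ∀ n : ℕ, Measurable fun ω =>
      (√(n : ℝ))⁻¹ • (toEuc (X n ω) - (n : ℝ) • velocity M p π) := fun n =>
    (measurable_of_countable fun y : Fin d → ℤ =>
      (√(n : ℝ))⁻¹ • (toEuc y - (n : ℝ) • velocity M p π)).comp (hX.measurable n)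
  refine ⟨fun n => (hmeas n).aemeasurable, aemeasurable_id, ?_⟩
  -- Lévy's continuity theorem; the characteristic function at `u` only sees the walk along `u`.
  refine ProbabilityMeasure.tendsto_iff_tendsto_charFun.2 fun u => ?_
  simp only [ProbabilityMeasure.coe_mk, Measure.map_id]
  rw [charFun_multivariateGaussian (posSemidef_asympCov hmom hirr hπ)]
  have := tendsto_integral_cexp_velocity hper hX hirr hmom hπ u.ofLp
  convert! this using 2 with n
  · rw [charFun_apply, integral_map (hmeas n).aemeasurable (by fun_prop)]
    refine integral_congr_ae (Eventually.of_forall fun ω => ?_)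
    simp only
    rw [real_inner_smul_left, Complex.ofReal_mul, PiLp.inner_apply]
    congr 4
  · simp [neg_div]

end CentralLimit

end RWPE
theorem proposition2 {d : ℕ} (M : Fin d → ℕ) [∀ i, NeZero (M i)]
    (p : RWPE.Environment d) (hper : RWPE.IsPeriodic M p)
    {Ω : Type*} [MeasurableSpace Ω] (Pr : Measure Ω) [IsProbabilityMeasure Pr]
    (X : ℕ → Ω → (Fin d → ℤ)) (hX : RWPE.IsWalk p X Pr)
    (hirr : (RWPE.transition M p).IsIrreducible)
    (haper : RWPE.IsAperiodic (RWPE.transition M p))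
    (hmom : ∀ x : RWPE.Torus M,
      Summable fun y : Fin d → ℤ => ‖RWPE.toEuc y‖ ^ 2 * RWPE.jump M p x y) :
    (∃! π : RWPE.Torus M → ℝ, RWPE.IsStationary (RWPE.transition M p) π) ∧
    ∀ π : RWPE.Torus M → ℝ, RWPE.IsStationary (RWPE.transition M p) π →
      -- `I - P` is invertible on the functions of mean zero, and the functions to which
      -- the inverse is applied in `Σ` have mean zero
      Set.BijOn (fun h : RWPE.Torus M → ℝ => (1 - RWPE.transition M p) *ᵥ h)
        (RWPE.meanZero π) (RWPE.meanZero π) ∧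
      (∀ j : Fin d, (fun z => ∑ w, RWPE.transition M p z w *
        (RWPE.condMean M p z w j - RWPE.velocity M p π j)) ∈ RWPE.meanZero π) ∧
      (RWPE.asympCov M p π).PosSemidef ∧
      TendstoInDistribution
        (fun (n : ℕ) (ω : Ω) =>
          (√(n : ℝ))⁻¹ • (RWPE.toEuc (X n ω) - (n : ℝ) • RWPE.velocity M p π))
        atTop (id : EuclideanSpace ℝ (Fin d) → EuclideanSpace ℝ (Fin d)) (fun _ => Pr)
        (multivariateGaussian 0 (RWPE.asympCov M p π)) := by
  have h1 := RWPE.transition_mulVec_one (M := M) (p := p)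
  refine ⟨RWPE.existsUnique_isStationary hirr h1, fun π hπ =>
    ⟨RWPE.bijOn_meanZero hirr h1 hπ, RWPE.drift_mem_meanZero hmom hπ,
      RWPE.posSemidef_asympCov hmom hirr hπ, RWPE.tendstoInDistribution_walk hper hX hirr hmom hπ⟩⟩
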